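/- Consider $n$ independent sporadic tasks $\tau_1,\dots,\tau_n$ with implicit deadlines: task $\tau_i$ has a worst-case execution time $C_i>0$ and a period $T_i>0$; it releases a (finite or infinite) sequence of jobs, consecutive releases being at least $T_i$ apart, each job needs at most $C_i$ units of execution, and its absolute deadline is $T_i$ after its release. Put $U_i=C_i/T_i$. The tasks are scheduled preemptively by global rate-monotonic (RM) scheduling on $M\ge 1$ identical processors: the tasks are indexed by decreasing priority with $T_1\le T_2\le\dots\le T_n$ (ties in the periods are broken arbitrarily, but in a fixed way), jobs of the same task execute in sequence, no job executes on two processors at once, and at every instant the $M$ highest-priority ready jobs (all of them, if there are fewer) are executed. A task is schedulable if, for all legal releases and execution times of the jobs of all tasks, each of its jobs finishes no later than its absolute deadline. Let $1\le k\le n$ and assume that all the higher-priority tasks $\tau_1,\dots,\tau_{k-1}$ are schedulable by global RM on the $M$ processors. Then $\tau_k$ is schedulable by global RM on the $M$ processors if $$\Bigl(\frac{C_k}{T_k}+2\Bigr)\prod_{j=1}^{k-1}\Bigl(\frac{U_j}{M}+1\Bigr)\le 3,$$ or if $$\sum_{j=1}^{k-1}\frac{U_j}{M}\le \ln\frac{3}{\frac{C_k}{T_k}+2}.$$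 -/

import Mathlib

open MeasureTheory

namespace SporadicRT

/-- A sporadic real-time task: worst-case execution time `C`, period (minimum inter-release
time) `T` and relative deadline `D`. -/
structure Task where
  C : ℝ
  T : ℝ
  D : ℝ
  C_pos : 0 < C
  T_pos : 0 < T
  D_pos : 0 < D

/-- The utilization `U = C / T` of a task. -/
noncomputable def Task.U (t : Task) : ℝ := t.C / t.T

/-- Every relative deadline equals the corresponding period. -/
def ImplicitDeadline {n : ℕ} (τ : Fin n → Task) : Prop := ∀ i, (τ i).D = (τ i).T

/-- The tasks are indexed by decreasing rate-monotonic priority: a smaller index means a higher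
priority, and a task of higher priority has a period that is no longer (tasks with equal periods
are ordered arbitrarily). -/
def RateMonotonicOrder {n : ℕ} (τ : Fin n → Task) : Prop := ∀ i j, i ≤ j → (τ i).T ≤ (τ j).T

/-- A legal collection of jobs of a sporadic task system. Task `i` releases `count i` jobs
(possibly none or infinitely many), the jobs `(i, j)` with `j < count i`; consecutive releases
of a task are separated by at least its period, and the actual execution time of a job is at most
the worst-case execution time of its task. -/
structure Jobs {n : ℕ} (τ : Fin n → Task) where
  count : Fin n → ℕ∞
  release : Fin n → ℕ → ℝ
  exec : Fin n → ℕ → ℝ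
  separated : ∀ (i : Fin n) (j : ℕ), ((j + 1 : ℕ) : ℕ∞) < count i →
    release i j + (τ i).T ≤ release i (j + 1)
  exec_nonneg : ∀ (i : Fin n) (j : ℕ), (j : ℕ∞) < count i → 0 ≤ exec i j
  exec_le : ∀ (i : Fin n) (j : ℕ), (j : ℕ∞) < count i → exec i j ≤ (τ i).C

/-- The absolute deadline of job `(i, j)`. -/
def Jobs.absDeadline {n : ℕ} {τ : Fin n → Task} (J : Jobs τ) (i : Fin n) (j : ℕ) : ℝ :=
  J.release i j + (τ i).D

/-- What each of the `M` processors does at each instant: `run t p = some (i, j)` if processor `p`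
executes job `(i, j)` at time `t`, and `run t p = none` if it idles. -/
abbrev Assignment (n M : ℕ) := ℝ → Fin M → Option (Fin n × ℕ)

/-- Job `(i, j)` is being executed at time `t`. -/
def Running {n M : ℕ} (run : Assignment n M) (i : Fin n) (j : ℕ) (t : ℝ) : Prop :=
  ∃ p, run t p = some (i, j)

/-- The amount of execution that job `(i, j)` has received from its release up to time `t`. -/
noncomputable def service {n M : ℕ} {τ : Fin n → Task} (J : Jobs τ) (run : Assignment n M)
    (i : Fin n) (j : ℕ) (t : ℝ) : ℝ :=
  volume.real {s | s ∈ Set.Ico (J.release i j) t ∧ Running run i j s}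

/-- Job `(i, j)` has received its whole execution time by time `t`, and it has been released. -/
def Finished {n M : ℕ} {τ : Fin n → Task} (J : Jobs τ) (run : Assignment n M)
    (i : Fin n) (j : ℕ) (t : ℝ) : Prop :=
  J.release i j ≤ t ∧ J.exec i j ≤ service J run i j t

/-- Job `(i, j)` is in the ready queue at time `t`: it exists, has been released, is not finished,
and all earlier jobs of the same task are finished (jobs of one task execute in sequence). -/
def Ready {n M : ℕ} {τ : Fin n → Task} (J : Jobs τ) (run : Assignment n M)
    (i : Fin n) (j : ℕ) (t : ℝ) : Prop :=
  (j : ℕ∞) < J.count i ∧ J.release i j ≤ t ∧ ¬ Finished J run i j t ∧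
    ∀ j' < j, Finished J run i j' t

/-- `run` is a schedule of the jobs `J` by preemptive global fixed-priority scheduling on `M`
identical processors, where a smaller task index means a higher priority. At every instant the
`M` highest-priority jobs of the ready queue (all of them, if there are fewer) are executed:
only ready jobs are executed, no job is on two processors at once, and a ready job waits only
while all processors execute jobs of higher priority. -/
structure IsGlobalFPSchedule {n M : ℕ} {τ : Fin n → Task} (J : Jobs τ)
    (run : Assignment n M) : Prop where
  measurable : ∀ i j, MeasurableSet {t | Running run i j t}
  ready_of_run : ∀ t p i j, run t p = some (i, j) → Ready J run i j t
  no_parallel : ∀ t p q i j, run t p = some (i, j) → run t q = some (i, j) → p = q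
  waits : ∀ t i j, Ready J run i j t → ¬ Running run i j t →
    ∀ p, ∃ i' j', run t p = some (i', j') ∧ i' < i

/-- Task `k` of `τ` is schedulable on `M` processors by preemptive global fixed-priority
scheduling with priorities given by the indices: for all legal collections of jobs, all jobs of
the task finish by their absolute deadlines. If the indices are in rate-monotonic order, this is
schedulability by global RM. -/
def Schedulable {n : ℕ} (τ : Fin n → Task) (M : ℕ) (k : Fin n) : Prop :=
  ∀ (J : Jobs τ) (run : Assignment n M), IsGlobalFPSchedule J run →
    ∀ j : ℕ, (j : ℕ∞) < J.count k → Finished J run k j (J.absDeadline k j)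

end SporadicRT

/-! A pending job of `τ k` waits only while all `M` processors serve higher-priority tasks, so its
response time is at most any `x` with `C_k` plus the higher-priority workload over `M` at most `x`.
With `m_i = ⌊T_k / T_i⌋` and `t_i = m_i T_i`, a window of length `x ≤ T_k` meets at most `m_i + 1 ≤
2 m_i` jobs of `τ i` if `x ≤ t_i`, and at most `m_i + 2 ≤ 3 m_i` otherwise (`volume_busy_le`). Since
`m_i C_i = t_i U_i`, the demand is bounded by a step function jumping just after the points `t_i`.
If it exceeded `x` at every `t_i` and at `T_k`, the discrete Grönwall inequality would contradict
the hyperbolic bound (`exists_demand_le_of_hyperbolic_bound`). -/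

namespace SporadicRT

/-! ### Inequalities: Grönwall, the hyperbolic bound, double counting -/

section Combinatorics

variable {ι : Type*}

/-- A discrete Grönwall inequality. -/
theorem add_sum_le_mul_prod_one_add (s : Finset ι) (t u : ι → ℝ) (S : ℝ)
    (ht : ∀ i ∈ s, 0 ≤ t i) (hu : ∀ i ∈ s, 0 ≤ u i)
    (h : ∀ i ∈ s, t i ≤ S + ∑ l ∈ s with t l < t i, t l * u l) :
    S + ∑ i ∈ s, t i * u i ≤ S * ∏ i ∈ s, (1 + u i) := by
  classical
  -- An element with maximal `t` lies in none of the strict filters, so the hypotheses on the others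
  -- survive its removal.
  induction s using Finset.induction_on_max_value t with
  | empty => simp
  | insert a s has hmax ih =>
    have ih' := ih (fun i hi => ht i (Finset.mem_insert_of_mem hi))
      (fun i hi => hu i (Finset.mem_insert_of_mem hi)) (fun i hi => by
        have := h i (Finset.mem_insert_of_mem hi)
        rwa [Finset.filter_insert, if_neg (not_lt.mpr (hmax i hi))] at this)
    have ha := h a (Finset.mem_insert_self a s)
    rw [Finset.filter_insert, if_neg (lt_irrefl _)] at ha
    have hsub : ∑ l ∈ s with t l < t a, t l * u l ≤ ∑ l ∈ s, t l * u l :=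
      Finset.sum_le_sum_of_subset_of_nonneg (Finset.filter_subset _ _) fun i hi _ =>
        mul_nonneg (ht i (Finset.mem_insert_of_mem hi)) (hu i (Finset.mem_insert_of_mem hi))
    have hua := hu a (Finset.mem_insert_self a s)
    rw [Finset.sum_insert has, Finset.prod_insert has]
    have h1 : t a * u a ≤ (S + ∑ l ∈ s, t l * u l) * u a :=
      mul_le_mul_of_nonneg_right (ha.trans (by linarith)) hua
    have h2 := mul_le_mul_of_nonneg_right ih' (by linarith : 0 ≤ 1 + u a)
    nlinarith

/-- The hyperbolic bound yields a point at which the linearized demand is met. -/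
theorem exists_demand_le_of_hyperbolic_bound (s : Finset ι) (t u : ι → ℝ) (C T : ℝ)
    (hC : 0 < C) (hT : 0 < T) (ht : ∀ i ∈ s, 0 < t i) (htT : ∀ i ∈ s, t i ≤ T)
    (hu : ∀ i ∈ s, 0 ≤ u i) (h : (C / T + 2) * ∏ i ∈ s, (u i + 1) ≤ 3) :
    ∃ x, 0 < x ∧ x ≤ T ∧
      C + ∑ i ∈ s, (2 + if t i < x then 1 else 0) * (t i * u i) ≤ x := by
  have key : ∀ x, C + ∑ i ∈ s, (2 + if t i < x then (1 : ℝ) else 0) * (t i * u i) =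
      (C + 2 * ∑ i ∈ s, t i * u i) + ∑ i ∈ s with t i < x, t i * u i := by
    intro x
    rw [Finset.sum_filter, add_assoc, Finset.mul_sum, ← Finset.sum_add_distrib]
    congr 1
    refine Finset.sum_congr rfl fun i _ => ?_
    split_ifs <;> ring
  by_contra! hcon
  simp only [key] at hcon
  set σ := ∑ i ∈ s, t i * u i with hσ
  have hσ0 : 0 ≤ σ := Finset.sum_nonneg fun i hi => mul_nonneg (ht i hi).le (hu i hi)
  -- Failure of the demand bound at `x = t i` is the Grönwall hypothesis with `S = C + 2σ`; the
  -- result is `C + 3σ ≤ (C + 2σ) Q`.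
  have hG := add_sum_le_mul_prod_one_add s t u (C + 2 * σ) (fun i hi => (ht i hi).le) hu
    (fun i hi => (hcon (t i) (ht i hi) (htT i hi)).le)
  have hTlt := hcon T hT le_rfl
  have hsub : ∑ i ∈ s with t i < T, t i * u i ≤ σ :=
    Finset.sum_le_sum_of_subset_of_nonneg (Finset.filter_subset _ _) fun i hi _ =>
      mul_nonneg (ht i hi).le (hu i hi)
  simp only [add_comm (1 : ℝ)] at hG
  rw [← hσ] at hG
  have hQ : 0 < ∏ i ∈ s, (u i + 1) :=
    Finset.prod_pos fun i hi => by linarith [hu i hi]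
  set Q := ∏ i ∈ s, (u i + 1)
  have h' : (C + 2 * T) * Q ≤ 3 * T := by
    have := mul_le_mul_of_nonneg_right h hT.le
    have e : (C / T + 2) * Q * T = (C + 2 * T) * Q := by field_simp
    linarith
  have hCQ : 0 < C * Q := mul_pos hC hQ
  have hpos : 0 < 3 - 2 * Q := by
    by_contra! hneg
    nlinarith
  have hy : T < C + 3 * σ := by linarith
  -- `C Q ≤ T (3 - 2Q) < (C + 3σ)(3 - 2Q) ≤ C Q`: the outer bounds are `h'` and `hG`.
  nlinarith [mul_lt_mul_of_pos_right hy hpos]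

/-- The logarithmic utilization bound implies the hyperbolic bound. -/
theorem hyperbolic_bound_of_sum_le_log (s : Finset ι) (u : ι → ℝ) (c : ℝ) (hc : 0 < c)
    (hu : ∀ i ∈ s, 0 ≤ u i) (h : ∑ i ∈ s, u i ≤ Real.log (3 / c)) :
    c * ∏ i ∈ s, (u i + 1) ≤ 3 := by
  have h1 : ∏ i ∈ s, (u i + 1) ≤ 3 / c := calc
    ∏ i ∈ s, (u i + 1) ≤ ∏ i ∈ s, Real.exp (u i) :=
      Finset.prod_le_prod (fun i hi => by linarith [hu i hi]) fun i _ => Real.add_one_le_exp _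
    _ = Real.exp (∑ i ∈ s, u i) := (Real.exp_sum _ _).symm
    _ ≤ Real.exp (Real.log (3 / c)) := Real.exp_le_exp.mpr h
    _ = 3 / c := Real.exp_log (by positivity)
  calc c * ∏ i ∈ s, (u i + 1) ≤ c * (3 / c) := mul_le_mul_of_nonneg_left h1 hc.le
    _ = 3 := by field_simp

/-- If every point of `B` lies in at least `M` of the sets `A i`, then `M` times the measure of
`B` is at most the sum of the measures of the `A i`. -/
theorem mul_measureReal_le_sum_of_le_card {α : Type*} [MeasurableSpace α] (μ : Measure α)
    (s : Finset ι) (A : ι → Set α) (B : Set α) (M : ℕ)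
    (hA : ∀ i ∈ s, MeasurableSet (A i)) (hAfin : ∀ i ∈ s, μ (A i) ≠ ⊤)
    (hB : MeasurableSet B)
    (h : ∀ x ∈ B, ∃ I ⊆ s, M ≤ I.card ∧ ∀ i ∈ I, x ∈ A i) :
    M * μ.real B ≤ ∑ i ∈ s, μ.real (A i) := by
  have hle : (M : ENNReal) * μ B ≤ ∑ i ∈ s, μ (A i) := calc
    (M : ENNReal) * μ B = ∫⁻ x, B.indicator (fun _ => (M : ENNReal)) x ∂μ := by
      rw [lintegral_indicator_const hB]
    _ ≤ ∫⁻ x, ∑ i ∈ s, (A i).indicator (fun _ => (1 : ENNReal)) x ∂μ := by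
      refine lintegral_mono fun x => ?_
      by_cases hx : x ∈ B
      · obtain ⟨I, hIs, hM, hI⟩ := h x hx
        rw [Set.indicator_of_mem hx]
        calc (M : ENNReal) ≤ (I.card : ENNReal) := by exact_mod_cast hM
          _ = ∑ i ∈ I, (A i).indicator (fun _ => (1 : ENNReal)) x := by
            rw [Finset.sum_congr rfl fun i hi => Set.indicator_of_mem (hI i hi) _]
            simp
          _ ≤ _ := Finset.sum_le_sum_of_subset hIs
      · simp [Set.indicator_of_notMem hx]
    _ = ∑ i ∈ s, μ (A i) := by
      rw [lintegral_finsetSum' s fun i hi =>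
        (measurable_const.indicator (hA i hi)).aemeasurable]
      refine Finset.sum_congr rfl fun i hi => ?_
      rw [lintegral_indicator_const (hA i hi), one_mul]
  have hfin : ∑ i ∈ s, μ (A i) ≠ ⊤ := ENNReal.sum_ne_top.mpr hAfin
  have := ENNReal.toReal_mono hfin hle
  rw [ENNReal.toReal_mul, ENNReal.toReal_natCast, ENNReal.toReal_sum hAfin] at this
  exact this

end Combinatorics

/-! ### Service, workload and interference in a schedule -/

section Service

variable {n M : ℕ} {τ : Fin n → Task} {J : Jobs τ} {run : Assignment n M}

theorem measure_window_ne_top (P : ℝ → Prop) (a b : ℝ) :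
    volume {s | s ∈ Set.Ico a b ∧ P s} ≠ ⊤ :=
  ((measure_mono fun _ hs => hs.1).trans_lt (measure_Ico_lt_top (a := a) (b := b))).ne

theorem service_mono (i : Fin n) (j : ℕ) : Monotone (service J run i j) := by
  intro a b hab
  exact measureReal_mono (fun s hs => ⟨⟨hs.1.1, hs.1.2.trans_le hab⟩, hs.2⟩)
    (measure_window_ne_top _ _ _)

theorem service_le_add (i : Fin n) (j : ℕ) {a b : ℝ} (hab : a ≤ b) :
    service J run i j b ≤ service J run i j a + (b - a) := by
  have hsub : {s | s ∈ Set.Ico (J.release i j) b ∧ Running run i j s} ⊆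
      {s | s ∈ Set.Ico (J.release i j) a ∧ Running run i j s} ∪ Set.Ico a b := by
    rintro s ⟨⟨h1, h2⟩, h3⟩
    rcases lt_or_ge s a with h | h
    · exact Or.inl ⟨⟨h1, h⟩, h3⟩
    · exact Or.inr ⟨h, h2⟩
  have hfin : volume ({s | s ∈ Set.Ico (J.release i j) a ∧ Running run i j s} ∪
      Set.Ico a b) ≠ ⊤ :=
    measure_union_ne_top (measure_window_ne_top _ _ _) measure_Ico_lt_top.ne
  calc service J run i j b ≤ _ := measureReal_mono hsub hfin
    _ ≤ service J run i j a + volume.real (Set.Ico a b) := measureReal_union_le _ _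
    _ = _ := by rw [Real.volume_real_Ico_of_le hab]

/-- Service is monotone and grows at rate at most one, hence is Lipschitz. Continuity yields an
exact completion instant in `service_le_exec`. -/
theorem service_continuous (i : Fin n) (j : ℕ) : Continuous (service J run i j) := by
  refine (LipschitzWith.of_le_add fun a b => ?_).continuous
  rcases le_total b a with h | h
  · rw [Real.dist_eq, abs_of_nonneg (sub_nonneg.mpr h)]
    exact service_le_add i j h
  · exact (service_mono i j h).trans (le_add_of_nonneg_right dist_nonneg)

theorem Finished.mono {i : Fin n} {j : ℕ} {a b : ℝ} (h : Finished J run i j a) (hab : a ≤ b) :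
    Finished J run i j b :=
  ⟨h.1.trans hab, h.2.trans (service_mono i j hab)⟩

theorem IsGlobalFPSchedule.ready (hrun : IsGlobalFPSchedule J run) {i : Fin n} {j : ℕ} {s : ℝ}
    (h : Running run i j s) : Ready J run i j s := by
  obtain ⟨p, hp⟩ := h
  exact hrun.ready_of_run s p i j hp

/-- At most one job of a task is ready at each instant. -/
theorem Ready.eq {i : Fin n} {j j' : ℕ} {s : ℝ} (h : Ready J run i j s)
    (h' : Ready J run i j' s) : j = j' := by
  rcases lt_trichotomy j j' with hlt | heq | hlt
  · exact absurd (h'.2.2.2 j hlt) h.2.2.1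
  · exact heq
  · exact absurd (h.2.2.2 j' hlt) h'.2.2.1

/-- A job receives no more service than its execution time. -/
theorem service_le_exec (hrun : IsGlobalFPSchedule J run) {i : Fin n} {j : ℕ}
    (hj : (j : ℕ∞) < J.count i) (t : ℝ) : service J run i j t ≤ J.exec i j := by
  by_contra! hlt
  have h0 : service J run i j (J.release i j) = 0 := by simp [service]
  have hrt : J.release i j ≤ t := by
    by_contra! h
    have := service_mono (J := J) (run := run) i j h.le
    linarith [J.exec_nonneg i j hj]
  -- At `a` the job is complete; from then on it is not ready, so it gains no service.
  obtain ⟨a, ha, hfa⟩ := intermediate_value_Icc hrt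
    (service_continuous (J := J) (run := run) i j).continuousOn
    (show J.exec i j ∈ Set.Icc _ _ from ⟨h0 ▸ J.exec_nonneg i j hj, hlt.le⟩)
  have hsub : service J run i j t ≤ service J run i j a := by
    refine measureReal_mono (fun s hs => ⟨⟨hs.1.1, ?_⟩, hs.2⟩) (measure_window_ne_top _ _ _)
    by_contra! has
    refine (hrun.ready hs.2).2.2.1 ⟨hs.1.1, ?_⟩
    exact hfa.symm.le.trans (service_mono i j has)
  linarith

theorem Jobs.release_add_le (J : Jobs τ) (i : Fin n) (j d : ℕ)
    (h : ((j + d : ℕ) : ℕ∞) < J.count i) :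
    J.release i j + d * (τ i).T ≤ J.release i (j + d) := by
  induction d with
  | zero => simp
  | succ d ih =>
    have h1 := ih (lt_of_le_of_lt (by exact_mod_cast (by omega : j + d ≤ j + (d + 1))) h)
    have h2 := J.separated i (j + d) h
    push_cast
    rw [← add_assoc j d 1]
    linarith

/-- The times in the window `[a, b)` at which some job of task `i` is executed. -/
def busy (run : Assignment n M) (i : Fin n) (a b : ℝ) : Set ℝ :=
  {s | s ∈ Set.Ico a b ∧ ∃ j, Running run i j s}

theorem measurableSet_busy (hrun : IsGlobalFPSchedule J run) (i : Fin n) (a b : ℝ) :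
    MeasurableSet (busy run i a b) := by
  have : busy run i a b = Set.Ico a b ∩ ⋃ j, {s | Running run i j s} := by
    ext s; simp [busy]
  rw [this]
  exact measurableSet_Ico.inter (MeasurableSet.iUnion fun j => hrun.measurable i j)

/-- The workload of a task that meets its implicit deadlines: at most one job is carried into the
window. -/
theorem volume_busy_le (hrun : IsGlobalFPSchedule J run) (i : Fin n) (hD : (τ i).D = (τ i).T)
    (hfin : ∀ j : ℕ, (j : ℕ∞) < J.count i → Finished J run i j (J.absDeadline i j))
    (a b : ℝ) (m : ℕ) (hm : b - a ≤ m * (τ i).T) :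
    volume.real (busy run i a b) ≤ (m + 1) * (τ i).C := by
  classical
  by_cases hne : ∃ j, ∃ s ∈ Set.Ico a b, Running run i j s
  swap
  · have : busy run i a b = ∅ := by
      ext s
      simp only [busy, Set.mem_ofPred_eq, Set.mem_empty_iff_false, iff_false]
      rintro ⟨hs, j, hj⟩
      exact hne ⟨j, s, hs, hj⟩
    rw [this, measureReal_empty]
    have := (τ i).C_pos
    positivity
  set j₀ := Nat.find hne
  have hwin : ∀ j s, s ∈ Set.Ico a b → Running run i j s →
      (j : ℕ∞) < J.count i ∧ a < J.release i j + (τ i).T ∧ J.release i j < b := by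
    intro j s hs hr
    have hrd := hrun.ready hr
    refine ⟨hrd.1, ?_, hrd.2.1.trans_lt hs.2⟩
    by_contra! hle
    refine hrd.2.2.1 ((hfin j hrd.1).mono ?_)
    rw [Jobs.absDeadline, hD]
    exact hle.trans hs.1
  have hbd : ∀ j s, s ∈ Set.Ico a b → Running run i j s → j ∈ Finset.Icc j₀ (j₀ + m) := by
    intro j s hs hr
    have hj₀ : j₀ ≤ j := Nat.find_min' hne ⟨s, hs, hr⟩
    obtain ⟨s₀, hs₀, hr₀⟩ := Nat.find_spec hne
    have h₀ := hwin _ s₀ hs₀ hr₀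
    have h₁ := hwin j s hs hr
    obtain ⟨d, rfl⟩ := Nat.exists_eq_add_of_le hj₀
    have hsep := J.release_add_le i j₀ d h₁.1
    -- Jobs run in the window are released after `a - T` (earlier ones have met their deadlines) and
    -- before `b`, a span of at most `(m + 1) T`.
    have hlt : (d : ℝ) * (τ i).T < (m + 1) * (τ i).T := by
      have h2 := h₀.2.1
      have h3 := h₁.2.2
      change a < J.release i j₀ + _ at h2
      linarith
    have hd : (d : ℝ) < m + 1 := lt_of_mul_lt_mul_right hlt (τ i).T_pos.le
    have hd' : d < m + 1 := by exact_mod_cast hd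
    rw [Finset.mem_Icc]
    omega
  have hsub : busy run i a b ⊆ ⋃ j ∈ Finset.Icc j₀ (j₀ + m),
      {s | s ∈ Set.Ico a b ∧ Running run i j s} := by
    rintro s ⟨hs, j, hj⟩
    exact Set.mem_biUnion (hbd j s hs hj) ⟨hs, hj⟩
  have hone : ∀ j, volume.real {s | s ∈ Set.Ico a b ∧ Running run i j s} ≤ (τ i).C := by
    intro j
    by_cases hj : (j : ℕ∞) < J.count i
    · calc _ ≤ service J run i j b :=
            measureReal_mono (fun s hs => ⟨⟨(hrun.ready hs.2).2.1, hs.1.2⟩, hs.2⟩)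
              (measure_window_ne_top _ _ _)
        _ ≤ J.exec i j := service_le_exec hrun hj b
        _ ≤ _ := J.exec_le i j hj
    · have : {s | s ∈ Set.Ico a b ∧ Running run i j s} = ∅ := by
        ext s
        simp only [Set.mem_ofPred_eq, Set.mem_empty_iff_false, iff_false]
        rintro ⟨_, hr⟩
        exact hj (hrun.ready hr).1
      rw [this, measureReal_empty]
      exact (τ i).C_pos.le
  have hfin' : volume (⋃ j ∈ Finset.Icc j₀ (j₀ + m),
      {s | s ∈ Set.Ico a b ∧ Running run i j s}) ≠ ⊤ := by
    refine ((measure_mono (Set.iUnion₂_subset fun j _ s hs => ?_)).trans_lt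
      (measure_Ico_lt_top (a := a) (b := b))).ne
    exact hs.1
  calc volume.real (busy run i a b) ≤ _ := measureReal_mono hsub hfin'
    _ ≤ ∑ j ∈ Finset.Icc j₀ (j₀ + m), volume.real {s | s ∈ Set.Ico a b ∧ Running run i j s} :=
      measureReal_biUnion_finset_le _ _
    _ ≤ ∑ j ∈ Finset.Icc j₀ (j₀ + m), (τ i).C := Finset.sum_le_sum fun j _ => hone j
    _ = (m + 1) * (τ i).C := by
      rw [Finset.sum_const, Nat.card_Icc, nsmul_eq_mul]
      congr 1
      rw [show j₀ + m + 1 - j₀ = m + 1 by omega]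
      push_cast
      rfl

/-- While a ready job waits, at least `M` tasks of higher priority are being executed. -/
theorem exists_finset_running_of_waiting (hrun : IsGlobalFPSchedule J run) {k : Fin n} {j : ℕ}
    {s : ℝ} (hready : Ready J run k j s) (hwait : ¬ Running run k j s) :
    ∃ I ⊆ Finset.Iio k, M ≤ I.card ∧ ∀ i ∈ I, ∃ j', Running run i j' s := by
  classical
  choose f g hfg hlt using hrun.waits s k j hready hwait
  -- Two processors on the same task would run its only ready job in parallel.
  have hinj : Function.Injective f := by
    intro p q hpq
    have hp := hrun.ready_of_run s p _ _ (hfg p)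
    have hq := hrun.ready_of_run s q _ _ (hfg q)
    rw [← hpq] at hq
    have hg : g p = g q := hp.eq hq
    refine hrun.no_parallel s p q (f p) (g p) (hfg p) ?_
    rw [hpq, hg]
    exact hfg q
  refine ⟨Finset.univ.image f, ?_, ?_, ?_⟩
  · intro i hi
    obtain ⟨p, -, rfl⟩ := Finset.mem_image.mp hi
    exact Finset.mem_Iio.mpr (hlt p)
  · rw [Finset.card_image_of_injective _ hinj]
    simp
  · intro i hi
    obtain ⟨p, -, rfl⟩ := Finset.mem_image.mp hi
    exact ⟨g p, p, hfg p⟩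

/-- A job that is at the head of its queue from its release on finishes within a window long enough
for its execution and the workload of the tasks of higher priority. -/
theorem finished_of_workload_le (hM : 0 < M) (hrun : IsGlobalFPSchedule J run) {k : Fin n} {j : ℕ}
    (hj : (j : ℕ∞) < J.count k)
    (hprev : ∀ j' < j, Finished J run k j' (J.release k j)) {x : ℝ} (hx : 0 ≤ x)
    (hW : (τ k).C + (∑ i ∈ Finset.Iio k,
      volume.real (busy run i (J.release k j) (J.release k j + x))) / M ≤ x) :
    Finished J run k j (J.release k j + x) := by
  by_contra hnf
  set r := J.release k j with hr
  have hready : ∀ s ∈ Set.Ico r (r + x), Ready J run k j s := fun s hs =>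
    ⟨hj, hs.1, fun hf => hnf (hf.mono hs.2.le), fun j' hj' => (hprev j' hj').mono hs.1⟩
  have hserv : service J run k j (r + x) < J.exec k j := by
    by_contra! h
    exact hnf ⟨by linarith, h⟩
  -- `B` is the waiting time: the job, unfinished at `r + x`, is ready throughout the window.
  set B : Set ℝ := Set.Ico r (r + x) \ {s | Running run k j s} with hBdef
  have hBmeas : MeasurableSet B := measurableSet_Ico.diff (hrun.measurable k j)
  have hMB : M * volume.real B ≤ ∑ i ∈ Finset.Iio k, volume.real (busy run i r (r + x)) := by
    refine mul_measureReal_le_sum_of_le_card volume _ _ B M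
      (fun i _ => measurableSet_busy hrun i _ _) (fun i _ => measure_window_ne_top _ _ _)
      hBmeas fun s hs => ?_
    obtain ⟨I, hI, hcard, hrunning⟩ :=
      exists_finset_running_of_waiting hrun (hready s hs.1) hs.2
    exact ⟨I, hI, hcard, fun i hi => ⟨hs.1, hrunning i hi⟩⟩
  have hsplit : x ≤ service J run k j (r + x) + volume.real B := calc
    x = volume.real (Set.Ico r (r + x)) := by
      rw [Real.volume_real_Ico_of_le (by linarith)]; ring
    _ ≤ volume.real ({s | s ∈ Set.Ico r (r + x) ∧ Running run k j s} ∪ B) := by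
      refine measureReal_mono (fun s hs => ?_) (measure_union_ne_top
        (measure_window_ne_top _ _ _) (measure_window_ne_top _ _ _))
      by_cases h : Running run k j s
      · exact Or.inl ⟨hs, h⟩
      · exact Or.inr ⟨hs, h⟩
    _ ≤ _ := measureReal_union_le _ _
  have hMpos : (0 : ℝ) < M := by exact_mod_cast hM
  have hB : volume.real B ≤
      (∑ i ∈ Finset.Iio k, volume.real (busy run i r (r + x))) / M := by
    rw [le_div_iff₀ hMpos]
    linarith
  linarith [J.exec_le k j hj]

end Service

/-! ### The schedulability test -/

/-- The hyperbolic test for global rate-monotonic scheduling. -/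
theorem schedulable_of_hyperbolic_bound {n : ℕ} (M : ℕ) (hM : 0 < M) (τ : Fin n → Task)
    (himplicit : ImplicitDeadline τ) (hRM : RateMonotonicOrder τ) (k : Fin n)
    (hhp : ∀ i < k, Schedulable τ M i)
    (htest : ((τ k).C / (τ k).T + 2) * ∏ j ∈ Finset.Iio k, ((τ j).U / (M : ℝ) + 1) ≤ 3) :
    Schedulable τ M k := by
  have hMpos : (0 : ℝ) < M := by exact_mod_cast hM
  have hCpos := fun i => (τ i).C_pos
  have hTpos := fun i => (τ i).T_pos
  let m : Fin n → ℕ := fun i => ⌊(τ k).T / (τ i).T⌋₊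
  have hm1 : ∀ i ∈ Finset.Iio k, 1 ≤ m i := fun i hi => by
    rw [Nat.one_le_floor_iff, one_le_div (hTpos i)]
    exact hRM i k (Finset.mem_Iio.mp hi).le
  have hmT : ∀ i, m i * (τ i).T ≤ (τ k).T := fun i =>
    (le_div_iff₀ (hTpos i)).mp (Nat.floor_le (div_pos (hTpos k) (hTpos i)).le)
  have hTm : ∀ i, (τ k).T ≤ (m i + 1) * (τ i).T := fun i =>
    (div_le_iff₀ (hTpos i)).mp (Nat.lt_floor_add_one _).le
  have hm1' : ∀ i ∈ Finset.Iio k, (1 : ℝ) ≤ m i := fun i hi => by exact_mod_cast hm1 i hi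
  obtain ⟨x, hx0, hxT, hx⟩ := exists_demand_le_of_hyperbolic_bound (Finset.Iio k)
    (fun i => m i * (τ i).T) (fun i => (τ i).U / M) (τ k).C (τ k).T (hCpos k) (hTpos k)
    (fun i hi => mul_pos (by linarith [hm1' i hi]) (hTpos i)) (fun i _ => hmT i)
    (fun i _ => div_nonneg (div_pos (hCpos i) (hTpos i)).le hMpos.le) htest
  intro J run hrun j
  induction j using Nat.strong_induction_on with
  | _ j ih =>
  intro hj
  -- With implicit deadlines, an earlier job is due no later than the release of job `j`.
  have hprev : ∀ j' < j, Finished J run k j' (J.release k j) := by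
    intro j' hj'
    have hj'c : (j' : ℕ∞) < J.count k := lt_trans (by exact_mod_cast hj') hj
    refine (ih j' hj' hj'c).mono ?_
    obtain ⟨d, rfl⟩ := Nat.exists_eq_add_of_lt hj'
    have h1 := J.release_add_le k j' (d + 1) hj
    have h2 : (0 : ℝ) ≤ d * (τ k).T := mul_nonneg (Nat.cast_nonneg d) (hTpos k).le
    rw [Jobs.absDeadline, himplicit k, add_assoc j' d 1]
    push_cast at h1
    linarith
  refine (finished_of_workload_le hM hrun hj hprev hx0.le ?_).mono ?_
  · refine le_trans ?_ hx
    rw [Finset.sum_div]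
    refine add_le_add_right (Finset.sum_le_sum fun i hi => ?_) _
    have hfin := hhp i (Finset.mem_Iio.mp hi) J run hrun
    have hU : (m i * (τ i).T) * ((τ i).U / M) = m i * (τ i).C / M := by
      have := (hTpos i).ne'
      rw [Task.U]
      field_simp
    rw [hU, ← mul_div_assoc]
    refine div_le_div_of_nonneg_right ?_ hMpos.le
    -- Since `m i ≥ 1` by the rate-monotonic order, the extra jobs are absorbed into multiples of `m
    -- i * C`, giving the coefficients 2 and 3.
    have hC : (τ i).C ≤ m i * (τ i).C := le_mul_of_one_le_left (hCpos i).le (hm1' i hi)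
    split_ifs with hlt
    · have := volume_busy_le hrun i (himplicit i) hfin (J.release k j) (J.release k j + x)
        (m i + 1) (by push_cast; linarith [hTm i])
      push_cast at this
      linarith
    · have := volume_busy_le hrun i (himplicit i) hfin (J.release k j) (J.release k j + x)
        (m i) (by linarith)
      linarith
  · rw [Jobs.absDeadline, himplicit k]
    linarith

end SporadicRT

theorem theorem3 {n : ℕ} (M : ℕ) (hM : 0 < M) (τ : Fin n → SporadicRT.Task)
    (himplicit : SporadicRT.ImplicitDeadline τ)
    (hRM : SporadicRT.RateMonotonicOrder τ) (k : Fin n)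
    (hhp : ∀ i < k, SporadicRT.Schedulable τ M i)
    (htest :
      ((τ k).C / (τ k).T + 2) * ∏ j ∈ Finset.Iio k, ((τ j).U / (M : ℝ) + 1) ≤ 3 ∨
      ∑ j ∈ Finset.Iio k, (τ j).U / (M : ℝ) ≤ Real.log (3 / ((τ k).C / (τ k).T + 2))) :
    SporadicRT.Schedulable τ M k := by
  refine SporadicRT.schedulable_of_hyperbolic_bound M hM τ himplicit hRM k hhp ?_
  rcases htest with h | h
  · exact h
  · refine SporadicRT.hyperbolic_bound_of_sum_le_log _ _ _ ?_ (fun i _ => ?_) h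
    · have := div_pos (τ k).C_pos (τ k).T_pos
      linarith
    · exact div_nonneg (div_pos (τ i).C_pos (τ i).T_pos).le (Nat.cast_nonneg M)
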